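/- Let $1\le d_1\le d_2$ be integers and, for integers $i\le j$, put $g_{i,j}(u,v)=(u-iv)(u-(i+1)v)\cdots(u-jv)\in\mathbb{C}[u,v]$. Let $M(\mathcal A)$ be the complement in the complex projective plane $\mathbb{P}^2$ (with homogeneous coordinates $(x:y:z)$ and its usual complex topology) of the line arrangement $$\mathcal A:\quad x\,g_{1,d_1}(x,y)\,g_{1,d_2}(x,z)=0 .$$ Then, for all subsets $S,T\subset\mathbb{C}$ with $|S|=d_1$ and $|T|=d_2$, the space $M(\mathcal A)$ is homeomorphic to $(\mathbb{C}\setminus S)\times(\mathbb{C}\setminus T)$. In particular, $M(\mathcal A)$ is a $K(\pi,1)$-space with $\pi=\mathbb{F}_{d_1}\times\mathbb{F}_{d_2}$, where $\mathbb{F}_m$ denotes the free group on $m$ generators; that is, $M(\mathcal A)$ is path connected, $\pi_1(M(\mathcal A))\cong\mathbb{F}_{d_1}\times\mathbb{F}_{d_2}$, and $\pi_n(M(\mathcal A))=0$ for all $n\ge 2$. -/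

import Mathlib

open scoped LinearAlgebra.Projectivization

namespace LineArr

/-- The quotient topology on a projective space `ℙ K V`, coming from `V ∖ {0}`. -/
instance projTopology (K V : Type*) [DivisionRing K] [AddCommGroup V] [Module K V]
    [TopologicalSpace V] : TopologicalSpace (ℙ K V) :=
  inferInstanceAs (TopologicalSpace (Quotient (projectivizationSetoid K V)))

/-- The complex projective plane, with homogeneous coordinates `(x : y : z)` indexed by `Fin 3`. -/
abbrev P2 : Type := ℙ ℂ (Fin 3 → ℂ)

/-- `g i j u v = (u - i v)(u - (i+1) v) ⋯ (u - j v)`. -/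
noncomputable def g {R : Type*} [CommRing R] (i j : ℤ) (u v : R) : R :=
  ∏ k ∈ Finset.Icc i j, (u - (k : R) * v)

/-- The polynomial `f = x g_{1,d₁}(x,y) g_{1,d₂}(x,z)` in `ℂ[x,y,z]`, with
`x = X 0`, `y = X 1`, `z = X 2`. -/
noncomputable def f (d₁ d₂ : ℕ) : MvPolynomial (Fin 3) ℂ :=
  MvPolynomial.X 0 * g 1 (d₁ : ℤ) (MvPolynomial.X 0) (MvPolynomial.X 1) *
    g 1 (d₂ : ℤ) (MvPolynomial.X 0) (MvPolynomial.X 2)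

/-- The zero locus `{F = 0}` in the projective plane: the points all of whose coordinate
vectors are zeros of `F`. -/
def zeroLocus (F : MvPolynomial (Fin 3) ℂ) : Set P2 :=
  {p | ∀ v ∈ p.submodule, MvPolynomial.eval v F = 0}

/-- The complement `M(𝒜)` of the line arrangement `𝒜 : f = 0` in the projective plane; it
carries the subspace topology. -/
abbrev complement (d₁ d₂ : ℕ) : Set P2 := (zeroLocus (f d₁ d₂))ᶜ

/-- `X` is a `K(G,1)`-space: it is path connected, its fundamental group is isomorphic to `G`,
and its higher homotopy groups vanish. -/
structure IsKPiOne (G : Type*) [Group G] (X : Type*) [TopologicalSpace X] : Prop where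
  pathConnected : PathConnectedSpace X
  fundamentalGroup : ∀ x : X, Nonempty (FundamentalGroup X x ≃* G)
  higher : ∀ n : ℕ, 2 ≤ n → ∀ x : X, Subsingleton (HomotopyGroup.Pi n X x)

end LineArr

/-! In the chart x = 1 the arrangement becomes the lines y = 1/k and z = 1/k, with x = 0 as the line
at infinity, so the complement is a product of two punctured planes (`complementHomeomorph`). Shears
of ℂ carry any d points to 1, …, d (`exists_homeomorph_image_eq_punctures`), so only the number of
punctures matters.

Being a K(G,1) passes to products and along homeomorphisms. It remains to find a contractible
covering of ℂ ∖ {1, …, d} with free deck group; `IsKPiOne.of_isQuotientCoveringMap` does the rest.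
The two planes slit below and above the punctures overlap in d + 1 vertical strips. Take copies of
both indexed by the free group, and glue the lower copy g to the upper copy s_j g over strip j,
where s_0 = 1 and s_1, …, s_d are the generators. This is `Cover d`.

The sheets are glued in the pattern of a tree. By recursion on reduced words (`sheets`), the points
of a half plane travel from i through the intervals shared by successive sheets. These homotopies
agree along all gluings (`agree_sheets`), so the covering projection is null-homotopic. Lifting the
null-homotopy contracts the connected covering space (`contractibleSpace_of_nullhomotopic`). -/

open scoped unitInterval
open Topology

namespace LineArr

/-! ### Generalized loops on the cube -/

section Cube

variable {N : Type*}

/-- The distance of a point of the cube to its centre, in the sup norm. -/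
noncomputable def cubeRadius [Fintype N] (y : N → I) : ℝ := ‖fun i => (y i : ℝ) - 1 / 2‖

lemma continuous_cubeRadius [Fintype N] : Continuous (cubeRadius : (N → I) → ℝ) := by
  unfold cubeRadius
  fun_prop

lemma cubeRadius_le [Fintype N] (y : N → I) : cubeRadius y ≤ 1 / 2 := by
  refine (pi_norm_le_iff_of_nonneg (by norm_num)).2 fun i => ?_
  rw [Real.norm_eq_abs, abs_le]
  have := (y i).2.1
  have := (y i).2.2
  constructor <;> linarith

lemma cubeRadius_of_mem_boundary [Fintype N] {y : N → I} (hy : y ∈ Cube.boundary N) :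
    cubeRadius y = 1 / 2 := by
  refine le_antisymm (cubeRadius_le y) ?_
  obtain ⟨i, hi⟩ := hy
  refine le_trans ?_ (norm_le_pi_norm (fun i => (y i : ℝ) - 1 / 2) i)
  rcases hi with h | h <;> norm_num [h]

/-- Expansion of the cube from its centre by the factor `1 + s`, followed by the projection
back to the cube. -/
noncomputable def cubeExpand (s : I) (y : N → I) : N → I := fun i =>
  Set.projIcc (0 : ℝ) 1 zero_le_one (1 / 2 + (1 + (s : ℝ)) * ((y i : ℝ) - 1 / 2))

lemma continuous_cubeExpand :
    Continuous fun q : I × (N → I) => cubeExpand q.1 q.2 := by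
  unfold cubeExpand
  refine continuous_pi fun i => continuous_projIcc.comp ?_
  fun_prop

lemma cubeExpand_zero (y : N → I) : cubeExpand 0 y = y := by
  ext i
  simp [cubeExpand, Set.projIcc_of_mem zero_le_one (y i).2]

lemma cubeExpand_mem_boundary (s : I) {y : N → I} (hy : y ∈ Cube.boundary N) :
    cubeExpand s y ∈ Cube.boundary N := by
  obtain ⟨i, hi⟩ := hy
  have := s.2.1
  refine ⟨i, hi.imp (fun h => ?_) fun h => ?_⟩
  · refine Set.projIcc_of_le_left _ ?_
    simp only [h, Set.Icc.coe_zero]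
    linarith
  · refine Set.projIcc_of_right_le _ ?_
    simp only [h, Set.Icc.coe_one]
    linarith

lemma cubeExpand_one_mem_boundary [Fintype N] {y : N → I} (hy : 1 / 4 < cubeRadius y) :
    cubeExpand 1 y ∈ Cube.boundary N := by
  by_contra hcon
  refine hy.not_ge ((pi_norm_le_iff_of_nonneg (by norm_num)).2 fun i => ?_)
  by_contra hi
  refine hcon ⟨i, ?_⟩
  rw [Real.norm_eq_abs, not_le, lt_abs] at hi
  rcases hi with h | h
  · refine Or.inr (Set.projIcc_of_right_le _ ?_)
    simp only [Set.Icc.coe_one]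
    linarith
  · refine Or.inl (Set.projIcc_of_le_left _ ?_)
    simp only [Set.Icc.coe_one]
    linarith

/-- The time function which vanishes on the boundary of the cube. -/
noncomputable def cubeTime [Fintype N] (s : I) (y : N → I) : I :=
  Set.projIcc (0 : ℝ) 1 zero_le_one (min (s : ℝ) (2 - 4 * cubeRadius y))

lemma continuous_cubeTime [Fintype N] : Continuous fun q : I × (N → I) => cubeTime q.1 q.2 := by
  unfold cubeTime
  refine continuous_projIcc.comp ?_
  have := continuous_cubeRadius (N := N)
  fun_prop

lemma cubeTime_zero [Fintype N] (y : N → I) : cubeTime 0 y = 0 :=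
  Set.projIcc_of_le_left _ (by simp)

lemma cubeTime_of_mem_boundary [Fintype N] (s : I) {y : N → I} (hy : y ∈ Cube.boundary N) :
    cubeTime s y = 0 :=
  Set.projIcc_of_le_left _ (by rw [cubeRadius_of_mem_boundary hy]; norm_num)

lemma cubeTime_one [Fintype N] {y : N → I} (hy : cubeRadius y ≤ 1 / 4) : cubeTime 1 y = 1 :=
  Set.projIcc_of_right_le _ (by simp only [Set.Icc.coe_one, le_min_iff]; constructor <;> linarith)

/-- In a contractible space every generalized loop is homotopic to the constant one. -/
theorem genLoop_homotopic_const [Fintype N] {E : Type*} [TopologicalSpace E]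
    [ContractibleSpace E] {e : E} (f : GenLoop N E e) : GenLoop.Homotopic f GenLoop.const := by
  obtain ⟨c, ⟨H⟩⟩ := id_nullhomotopic E
  have hf : Continuous f := f.1.continuous
  have hH : Continuous H := H.continuous
  have hτ := continuous_cubeTime (N := N)
  have hσ := continuous_cubeExpand (N := N)
  -- The free homotopy `H` moves the base point. So `f` is squeezed into the cube of radius 1/4, and
  -- the time is cut off to 0 in the remaining collar, where the squeezed loop is constantly `e`.
  -- Inside radius 1/4 the time is 1 and `H` is constant. Hence `f` and the constant loop both
  -- deform rel boundary to the map `g`, which depends only on the track of `e`.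
  have key : ∀ y : N → I, H (cubeTime 1 y, f (cubeExpand 1 y)) = H (cubeTime 1 y, e) := by
    intro y
    by_cases hy : 1 / 4 < cubeRadius y
    · rw [GenLoop.boundary f _ (cubeExpand_one_mem_boundary hy)]
    · rw [cubeTime_one (not_lt.1 hy)]
      simp
  let g : C(N → I, E) := ⟨fun y => H (cubeTime 1 y, e),
    hH.comp ((hτ.comp (Continuous.prodMk continuous_const continuous_id)).prodMk
      continuous_const)⟩
  have h₁ : f.1.HomotopicRel g (Cube.boundary N) := ⟨{
    toFun := fun q => H (cubeTime q.1 q.2, f (cubeExpand q.1 q.2))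
    continuous_toFun := hH.comp (hτ.prodMk (hf.comp hσ))
    map_zero_left := fun y => by simp [cubeTime_zero, cubeExpand_zero]
    map_one_left := fun y => key y
    prop' := fun s y hy => by
      change H (cubeTime s y, f (cubeExpand s y)) = f y
      rw [cubeTime_of_mem_boundary s hy, GenLoop.boundary f _ (cubeExpand_mem_boundary s hy),
        GenLoop.boundary f _ hy]
      simp }⟩
  have h₂ : (GenLoop.const : GenLoop N E e).1.HomotopicRel g (Cube.boundary N) := ⟨{
    toFun := fun q => H (q.1 * cubeTime 1 q.2, e)
    continuous_toFun := hH.comp ((continuous_fst.mul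
      (hτ.comp (Continuous.prodMk continuous_const continuous_snd))).prodMk continuous_const)
    map_zero_left := fun y => by simp [GenLoop.const]
    map_one_left := fun y => by simp [g]
    prop' := fun s y hy => by
      change H (s * cubeTime 1 y, e) = e
      rw [cubeTime_of_mem_boundary 1 hy]
      simp }⟩
  exact h₁.trans h₂.symm

lemma isPreconnected_face [DecidableEq N] (i : N) (a : I) :
    IsPreconnected {y : N → I | y i = a} := by
  have : {y : N → I | y i = a} = (fun y : N → I => Function.update y i a) '' Set.univ := by
    ext y
    refine ⟨fun h => ⟨y, trivial, by rw [← Set.mem_ofPred.1 h]; simp⟩, ?_⟩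
    rintro ⟨z, -, rfl⟩
    simp
  rw [this]
  exact isPreconnected_univ.image _ (by fun_prop)

/-- A point on a face in direction i is joined to the corner 0 through that face and the face where
some other coordinate j vanishes; faces in different directions intersect. -/
theorem isPreconnected_boundary [DecidableEq N] [Nontrivial N] :
    IsPreconnected (Cube.boundary N) := by
  refine isPreconnected_of_forall (0 : N → I) fun y hy => ?_
  have sub : ∀ (i : N) (a : I), (a = 0 ∨ a = 1) →
      {y : N → I | y i = a} ⊆ Cube.boundary N := fun i a ha y hy => ⟨i, by
    rw [Set.mem_ofPred.1 hy]; exact ha⟩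
  obtain ⟨i, hi⟩ := hy
  obtain ⟨j, hj⟩ := exists_ne i
  -- The first factor is the whole cube and drops out; the union of the two faces is what matters.
  refine ⟨{y | y i = y i} ∩ ({z | z i = y i} ∪ {z | z j = 0}), ?_, ⟨rfl, .inr rfl⟩,
    ⟨rfl, .inl rfl⟩, ?_⟩
  · rintro z ⟨-, hz | hz⟩
    · exact sub i _ hi hz
    · exact sub j _ (.inl rfl) hz
  · simp only [Set.ofPred_true, Set.univ_inter]
    refine IsPreconnected.union (Function.update (0 : N → I) i (y i)) ?_ ?_
      (isPreconnected_face i _) (isPreconnected_face j _)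
    · simp
    · simp [hj]

end Cube

/-! ### Coverings, products and K(G,1)-spaces -/

/-- Shrinking the cube to its corner 0 makes `f` the end of a homotopy from a constant map, so `f`
lifts to `E`. For n ≥ 2 the boundary is connected, so the lift is constant on it and is a
generalized loop in a contractible space. The resulting null-homotopy is projected back to `X`. -/
theorem subsingleton_homotopyGroup_of_isCoveringMap {E X : Type*} [TopologicalSpace E]
    [TopologicalSpace X] [ContractibleSpace E] {p : E → X} (hp : IsCoveringMap p)
    (hs : Function.Surjective p) {n : ℕ} (hn : 2 ≤ n) (x : X) :
    Subsingleton (HomotopyGroup.Pi n X x) := by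
  have : Nontrivial (Fin n) := Fin.nontrivial_iff_two_le.2 hn
  obtain ⟨e, rfl⟩ := hs x
  suffices h : ∀ f : GenLoop (Fin n) X (p e), GenLoop.Homotopic f GenLoop.const by
    refine ⟨fun a b => ?_⟩
    induction a using Quotient.inductionOn with | _ a =>
    induction b using Quotient.inductionOn with | _ b =>
    exact Quotient.sound ((h a).trans (h b).symm)
  intro f
  have h0 : (0 : Fin n → I) ∈ Cube.boundary (Fin n) :=
    ⟨⟨0, by omega⟩, .inl rfl⟩
  let G : C(I × (Fin n → I), X) := ⟨fun q => f fun i => q.1 * q.2 i,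
    f.1.continuous.comp (by fun_prop)⟩
  have hG : ∀ y, G (0, y) = p (ContinuousMap.const (Fin n → I) e y) := fun y => by
    refine Eq.trans ?_ (GenLoop.boundary f 0 h0)
    exact congr_arg f (by ext; simp)
  let L := hp.liftHomotopy G (.const _ e) hG
  let F : C(Fin n → I, E) := L.comp ((ContinuousMap.const _ 1).prodMk (.id _))
  have hF' : ∀ y, p (F y) = f y := fun y => by
    refine (congr_fun (hp.liftHomotopy_lifts G (.const _ e) hG) (1, y)).trans ?_
    exact congr_arg f (by ext; simp)
  have hFb : ∀ y ∈ Cube.boundary (Fin n), F y = e := fun y hy => by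
    have hF0 : F 0 = e := by
      have hc : ∀ t, L (t, 0) = L (0, 0) := fun t =>
        hp.const_of_comp (g := fun t => L (t, 0)) (by fun_prop) (fun a b => by
          have hL := fun t => congr_fun (hp.liftHomotopy_lifts G (.const _ e) hG) (t, 0)
          refine (hL a).trans (Eq.trans ?_ (hL b).symm)
          exact congr_arg f (by ext; simp)) t 0
      exact (hc 1).trans (hp.liftHomotopy_zero G (.const _ e) hG 0)
    rw [← hF0]
    exact hp.constOn_of_comp isPreconnected_boundary F.continuous.continuousOn
      (fun a ha b hb => by rw [hF', hF', GenLoop.boundary f _ ha, GenLoop.boundary f _ hb]) hy h0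
  obtain ⟨H⟩ := genLoop_homotopic_const (⟨F, hFb⟩ : GenLoop (Fin n) E e)
  have hpc := hp.continuous
  exact ⟨{
    toFun := fun q => p (H q)
    continuous_toFun := hpc.comp H.continuous
    map_zero_left := fun y => by
      rw [H.apply_zero]; exact hF' y
    map_one_left := fun y => by rw [H.apply_one]; rfl
    prop' := fun s y hy => by
      change p (H (s, y)) = f y
      rw [H.eq_fst s hy]
      exact hF' y }⟩

/-- The base of a quotient covering map with contractible total space and group `G` is a
`K(G,1)`-space. -/
theorem IsKPiOne.of_isQuotientCoveringMap {E X G : Type*} [TopologicalSpace E]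
    [TopologicalSpace X] [Group G] [MulAction G E] [ContractibleSpace E] {p : E → X}
    (hp : IsQuotientCoveringMap p G) : IsKPiOne G X where
  pathConnected := by
    have := hp.surjective.pathConnectedSpace hp.continuous
    exact this
  fundamentalGroup x := by
    obtain ⟨e, rfl⟩ := hp.surjective x
    -- Monodromy identifies the fundamental group with the opposite of `G`; inversion undoes the
    -- opposite.
    exact ⟨(hp.fundamentalGroupEquiv ⟨e, rfl⟩).trans (MulEquiv.inv' G).symm⟩
  higher n hn x := subsingleton_homotopyGroup_of_isCoveringMap hp.isCoveringMap hp.surjective hn x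

/-- The fundamental group of a product. -/
noncomputable def fundamentalGroupProdEquiv {X Y : Type*} [TopologicalSpace X]
    [TopologicalSpace Y] (x : X) (y : Y) :
    FundamentalGroup (X × Y) (x, y) ≃* FundamentalGroup X x × FundamentalGroup Y y where
  toFun γ := (FundamentalGroup.map ⟨Prod.fst, continuous_fst⟩ (x, y) γ,
    FundamentalGroup.map ⟨Prod.snd, continuous_snd⟩ (x, y) γ)
  invFun γ := Path.Homotopic.prod γ.1 γ.2
  left_inv γ := Path.Homotopic.prod_projLeft_projRight γ
  right_inv γ := Prod.ext (Path.Homotopic.projLeft_prod γ.1 γ.2)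
    (Path.Homotopic.projRight_prod γ.1 γ.2)
  map_mul' γ δ := by
    simp only [map_mul]
    rfl

theorem IsKPiOne.prod {X Y G H : Type*} [TopologicalSpace X] [TopologicalSpace Y] [Group G]
    [Group H] (hX : IsKPiOne G X) (hY : IsKPiOne H Y) : IsKPiOne (G × H) (X × Y) where
  pathConnected := by
    have := hX.pathConnected
    have := hY.pathConnected
    infer_instance
  fundamentalGroup := by
    rintro ⟨x, y⟩
    obtain ⟨φ⟩ := hX.fundamentalGroup x
    obtain ⟨ψ⟩ := hY.fundamentalGroup y
    exact ⟨(fundamentalGroupProdEquiv x y).trans (φ.prodCongr ψ)⟩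
  higher := by
    rintro n hn ⟨x, y⟩
    have h₁ := hX.higher n hn x
    have h₂ := hY.higher n hn y
    refine ⟨fun a b => ?_⟩
    induction a using Quotient.inductionOn with | _ a =>
    induction b using Quotient.inductionOn with | _ b =>
    have fstLoop : ∀ c : GenLoop (Fin n) (X × Y) (x, y), ∀ z ∈ Cube.boundary (Fin n),
        (ContinuousMap.fst.comp c.1) z = x := fun c z hz => congr_arg Prod.fst (c.2 z hz)
    have sndLoop : ∀ c : GenLoop (Fin n) (X × Y) (x, y), ∀ z ∈ Cube.boundary (Fin n),
        (ContinuousMap.snd.comp c.1) z = y := fun c z hz => congr_arg Prod.snd (c.2 z hz)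
    obtain ⟨F⟩ := Quotient.exact (h₁.elim (Quotient.mk _ ⟨_, fstLoop a⟩)
      (Quotient.mk _ ⟨_, fstLoop b⟩))
    obtain ⟨F'⟩ := Quotient.exact (h₂.elim (Quotient.mk _ ⟨_, sndLoop a⟩)
      (Quotient.mk _ ⟨_, sndLoop b⟩))
    exact Quotient.sound ⟨F.prod F'⟩

theorem IsKPiOne.of_homeomorph {X Y G : Type*} [TopologicalSpace X] [TopologicalSpace Y]
    [Group G] (φ : X ≃ₜ Y) (hY : IsKPiOne G Y) : IsKPiOne G X where
  pathConnected := by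
    have := hY.pathConnected
    exact φ.symm.surjective.pathConnectedSpace φ.symm.continuous
  fundamentalGroup x := by
    obtain ⟨ψ⟩ := hY.fundamentalGroup (φ x)
    let F : FundamentalGroup X x ≃* FundamentalGroup Y (φ x) := (CategoryTheory.Functor.FullyFaithful.ofFullyFaithful
      (FundamentalGroupoidFunctor.equivOfHomotopyEquiv φ.toHomotopyEquiv).functor).mulEquivEnd
      (FundamentalGroupoid.mk x)
    exact ⟨F.trans ψ⟩
  higher n hn x := by
    have h := hY.higher n hn (φ x)
    refine ⟨fun a b => ?_⟩
    induction a using Quotient.inductionOn with | _ a =>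
    induction b using Quotient.inductionOn with | _ b =>
    have loop : ∀ c : GenLoop (Fin n) X x, ∀ z ∈ Cube.boundary (Fin n),
        ((φ : C(X, Y)).comp c.1) z = φ x := fun c z hz => congr_arg φ (c.2 z hz)
    obtain ⟨F⟩ := Quotient.exact (h.elim (Quotient.mk _ ⟨_, loop a⟩) (Quotient.mk _ ⟨_, loop b⟩))
    exact Quotient.sound ⟨(ContinuousMap.HomotopyRel.compContinuousMap F (φ.symm : C(Y, X))).cast (by ext; simp) (by ext; simp)⟩

/-! ### Moving finite sets of points by shears -/

/-- The vertical shear `x + i y ↦ x + i (y + q x)`. -/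
noncomputable def shearIm (q : C(ℝ, ℝ)) : ℂ ≃ₜ ℂ where
  toFun z := z + (q z.re : ℂ) * Complex.I
  invFun z := z - (q z.re : ℂ) * Complex.I
  left_inv z := by simp
  right_inv z := by simp
  continuous_toFun := by fun_prop
  continuous_invFun := by fun_prop

/-- The horizontal shear `x + i y ↦ x + q y + i y`. -/
noncomputable def shearRe (q : C(ℝ, ℝ)) : ℂ ≃ₜ ℂ where
  toFun z := z + (q z.im : ℂ)
  invFun z := z - (q z.im : ℂ)
  left_inv z := by simp
  right_inv z := by simp
  continuous_toFun := by fun_prop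
  continuous_invFun := by fun_prop

lemma shearIm_apply (q : C(ℝ, ℝ)) (z : ℂ) : shearIm q z = z + (q z.re : ℂ) * Complex.I := rfl

lemma shearRe_apply (q : C(ℝ, ℝ)) (z : ℂ) : shearRe q z = z + (q z.im : ℂ) := rfl

lemma exists_continuous_interpolation {ι : Type*} (s : Finset ι) (v r : ι → ℝ)
    (hv : Set.InjOn v s) : ∃ q : C(ℝ, ℝ), ∀ i ∈ s, q (v i) = r i := by
  classical
  exact ⟨⟨fun x => (Lagrange.interpolate s v r).eval x, Polynomial.continuous _⟩,
    fun i hi => Lagrange.eval_interpolate_at_node r hv hi⟩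

/-- Two points with different imaginary parts collide for exactly one t, so finitely many t are
excluded. Points with equal imaginary parts never collide unless they are equal. -/
lemma exists_injOn_re_add_mul_im (S : Finset ℂ) :
    ∃ t : ℝ, Set.InjOn (fun z : ℂ => z.re + t * z.im) S := by
  classical
  obtain ⟨t, ht⟩ := Infinite.exists_notMem_finset
    ((S ×ˢ S).image fun p : ℂ × ℂ => -(p.1.re - p.2.re) / (p.1.im - p.2.im))
  refine ⟨t, fun a ha b hb hab => ?_⟩
  simp only at hab
  have him : a.im = b.im := by
    by_contra h
    refine ht (Finset.mem_image.2 ⟨(a, b), Finset.mk_mem_product ha hb, ?_⟩)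
    rw [div_eq_iff (sub_ne_zero.2 h)]
    simp only
    linarith
  refine Complex.ext ?_ him
  rw [him] at hab
  linarith

/-- The punctures `1, …, d`. -/
def punctures (d : ℕ) : Set ℂ := (fun k : ℕ => (k : ℂ)) '' Set.Icc 1 d

/-- Any finite set of points can be moved to `1, …, d` by a homeomorphism of the plane. -/
theorem exists_homeomorph_image_eq_punctures (S : Finset ℂ) :
    ∃ φ : ℂ ≃ₜ ℂ, φ '' (S : Set ℂ) = punctures S.card := by
  classical
  obtain ⟨t, ht⟩ := exists_injOn_re_add_mul_im S
  let n : ℂ → ℕ := fun z => if h : z ∈ S then (S.equivFin ⟨z, h⟩ : ℕ) + 1 else 0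
  have hn : ∀ z (h : z ∈ S), n z = (S.equivFin ⟨z, h⟩ : ℕ) + 1 := fun z h => dif_pos h
  have hinj : Set.InjOn n S := fun a ha b hb hab => by
    rw [hn a ha, hn b hb] at hab
    have := S.equivFin.injective (Fin.ext (Nat.succ_injective hab))
    exact congr_arg Subtype.val this
  have himg : n '' (S : Set ℂ) = Set.Icc 1 S.card := by
    ext k
    constructor
    · rintro ⟨z, hz, rfl⟩
      rw [hn z hz]
      have := (S.equivFin ⟨z, hz⟩).2
      exact ⟨by omega, by omega⟩
    · rintro ⟨h1, h2⟩
      refine ⟨S.equivFin.symm ⟨k - 1, by omega⟩, Subtype.prop _, ?_⟩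
      rw [hn _ (Subtype.prop _)]
      simp only [Subtype.coe_eta, Equiv.apply_symm_apply]
      omega
  -- The first shear makes the real parts distinct, so the second can set the imaginary parts to the
  -- labels `n z`. These are distinct, so the third can set the real parts to `n z`; the last
  -- subtracts the real part from the imaginary part.
  let q₀ : C(ℝ, ℝ) := ⟨fun y => t * y, by fun_prop⟩
  obtain ⟨q₁, hq₁⟩ := exists_continuous_interpolation S (fun z : ℂ => z.re + t * z.im)
    (fun z => n z - z.im) ht
  obtain ⟨q₂, hq₂⟩ := exists_continuous_interpolation S (fun z : ℂ => (n z : ℝ))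
    (fun z => n z - (z.re + t * z.im)) (fun a ha b hb hab => hinj ha hb (Nat.cast_injective hab))
  let q₃ : C(ℝ, ℝ) := ⟨fun y => - y, by fun_prop⟩
  refine ⟨(((shearRe q₀).trans (shearIm q₁)).trans (shearRe q₂)).trans (shearIm q₃), ?_⟩
  have h₁ : ∀ z ∈ S, ((((shearRe q₀).trans (shearIm q₁)).trans (shearRe q₂)).trans
      (shearIm q₃)) z = (n z : ℂ) := by
    intro z hz
    have e₁ := hq₁ z hz
    have e₂ := hq₂ z hz
    simp only [Homeomorph.trans_apply]
    have s₀ : shearRe q₀ z = ⟨z.re + t * z.im, z.im⟩ := by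
      apply Complex.ext <;> simp [shearRe_apply, q₀]
    have s₁ : shearIm q₁ ⟨z.re + t * z.im, z.im⟩ = ⟨z.re + t * z.im, n z⟩ := by
      apply Complex.ext <;> simp [shearIm_apply, e₁]
    have s₂ : shearRe q₂ ⟨z.re + t * z.im, n z⟩ = ⟨n z, n z⟩ := by
      apply Complex.ext <;> simp [shearRe_apply, e₂]
    have s₃ : shearIm q₃ ⟨n z, n z⟩ = (n z : ℂ) := by
      apply Complex.ext <;> simp [shearIm_apply, q₃]
    rw [s₀, s₁, s₂, s₃]
  rw [Set.image_congr (fun z hz => h₁ z hz), punctures, ← himg, Set.image_image]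

theorem nonempty_homeomorph_compl_punctures (S : Finset ℂ) :
    Nonempty (↥((S : Set ℂ)ᶜ) ≃ₜ ↥((punctures S.card)ᶜ)) := by
  obtain ⟨φ, hφ⟩ := exists_homeomorph_image_eq_punctures S
  refine ⟨φ.subtype fun z => ?_⟩
  rw [← hφ, Set.mem_compl_iff, Set.mem_compl_iff, φ.injective.mem_set_image]

/-! ### The complement in the affine chart x = 1 -/

lemma eval_f (d₁ d₂ : ℕ) (v : Fin 3 → ℂ) :
    MvPolynomial.eval v (f d₁ d₂) =
      v 0 * (∏ k ∈ Finset.Icc (1 : ℤ) d₁, (v 0 - k * v 1)) *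
        ∏ k ∈ Finset.Icc (1 : ℤ) d₂, (v 0 - k * v 2) := by
  simp [f, g, map_prod]

/-- The case a = 0 is included because `zeroLocus` tests every vector of the line, zero among them.
-/
lemma eval_f_smul (d₁ d₂ : ℕ) (a : ℂ) (v : Fin 3 → ℂ) (h : MvPolynomial.eval v (f d₁ d₂) = 0) :
    MvPolynomial.eval (a • v) (f d₁ d₂) = 0 := by
  rw [eval_f] at h ⊢
  have e : ∀ (k : ℤ) (i : Fin 3), (a • v) 0 - k * (a • v) i = a * (v 0 - k * v i) := by
    intro k i
    simp only [Pi.smul_apply, smul_eq_mul]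
    ring
  simp only [e, Finset.prod_mul_distrib]
  rw [Pi.smul_apply, smul_eq_mul]
  linear_combination (a * (∏ _k ∈ Finset.Icc (1 : ℤ) d₁, a) * ∏ _k ∈ Finset.Icc (1 : ℤ) d₂, a) * h

/-- The quotient map from nonzero vectors to the projective plane. -/
noncomputable def toP2 (v : {v : Fin 3 → ℂ // v ≠ 0}) : P2 := Projectivization.mk' ℂ v

lemma isQuotientMap_toP2 : IsQuotientMap toP2 := isQuotientMap_quot_mk

lemma toP2_mem_complement {d₁ d₂ : ℕ} (v : {v : Fin 3 → ℂ // v ≠ 0}) :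
    toP2 v ∈ complement d₁ d₂ ↔ MvPolynomial.eval v.1 (f d₁ d₂) ≠ 0 := by
  rw [complement, Set.mem_compl_iff, not_iff_not]
  change (∀ w ∈ (toP2 v).submodule, MvPolynomial.eval w (f d₁ d₂) = 0) ↔ _
  rw [toP2, Projectivization.mk'_eq_mk, Projectivization.submodule_mk]
  refine ⟨fun h => h _ (Submodule.mem_span_singleton_self _), fun h w hw => ?_⟩
  obtain ⟨a, rfl⟩ := Submodule.mem_span_singleton.1 hw
  exact eval_f_smul d₁ d₂ a _ h

/-- A quotient map restricts to a quotient map over an open set, so continuity on the complement can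
be tested on coordinate vectors. -/
lemma isOpen_complement (d₁ d₂ : ℕ) : IsOpen (complement d₁ d₂) := by
  rw [← isQuotientMap_toP2.isOpen_preimage]
  have : toP2 ⁻¹' complement d₁ d₂ =
      {v : {v : Fin 3 → ℂ // v ≠ 0} | MvPolynomial.eval v.1 (f d₁ d₂) ≠ 0} := by
    ext v
    exact toP2_mem_complement v
  rw [this]
  exact isOpen_ne_fun ((MvPolynomial.continuous_eval _).comp continuous_subtype_val)
    continuous_const

/-- The affine coordinate `v i / v 0` on the projective plane. -/
noncomputable def affineCoord (i : Fin 3) : P2 → ℂ :=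
  Projectivization.lift (fun v : {v : Fin 3 → ℂ // v ≠ 0} => v.1 i / v.1 0) (by
    rintro ⟨v, hv⟩ ⟨w, hw⟩ t h
    simp only at h
    have ht : t ≠ 0 := by
      rintro rfl
      exact hv (by simpa using h)
    simp only [h, Pi.smul_apply, smul_eq_mul]
    exact mul_div_mul_left _ _ ht)

lemma affineCoord_toP2 (i : Fin 3) (v : {v : Fin 3 → ℂ // v ≠ 0}) :
    affineCoord i (toP2 v) = v.1 i / v.1 0 := rfl

lemma apply_zero_ne_zero_of_mem {d₁ d₂ : ℕ} {v : {v : Fin 3 → ℂ // v ≠ 0}}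
    (h : toP2 v ∈ complement d₁ d₂) : v.1 0 ≠ 0 := by
  rw [toP2_mem_complement, eval_f] at h
  exact left_ne_zero_of_mul (left_ne_zero_of_mul h)

lemma continuous_affineCoord (d₁ d₂ : ℕ) (i : Fin 3) :
    Continuous fun p : complement d₁ d₂ => affineCoord i p := by
  have hq := isQuotientMap_toP2.restrictPreimage_isOpen (isOpen_complement d₁ d₂)
  rw [hq.continuous_iff]
  change Continuous fun v : toP2 ⁻¹' complement d₁ d₂ => v.1.1 i / v.1.1 0
  have h : ∀ j, Continuous fun v : toP2 ⁻¹' complement d₁ d₂ => v.1.1 j := fun j =>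
    ((continuous_apply j).comp continuous_subtype_val).comp continuous_subtype_val
  exact (h i).div (h 0) fun v => apply_zero_ne_zero_of_mem v.2

/-- The vector `(1, y, z)`. -/
def affineVec (w : ℂ × ℂ) : {v : Fin 3 → ℂ // v ≠ 0} :=
  ⟨![1, w.1, w.2], fun h => one_ne_zero (congr_fun h 0)⟩

lemma continuous_affineVec : Continuous affineVec := by
  refine Continuous.subtype_mk (continuous_pi fun i => ?_) _
  fin_cases i
  · exact continuous_const
  · exact continuous_fst
  · exact continuous_snd

/-- The points `1, 1/2, …, 1/d`. -/
noncomputable def invPunctures (d : ℕ) : Finset ℂ :=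
  (Finset.Icc 1 d).image fun k : ℕ => (k : ℂ)⁻¹

lemma card_invPunctures (d : ℕ) : (invPunctures d).card = d := by
  rw [invPunctures, Finset.card_image_of_injective]
  · simp
  · intro a b h
    exact_mod_cast inv_injective h

lemma notMem_invPunctures {d : ℕ} {a w : ℂ} (ha : a ≠ 0) :
    w / a ∉ invPunctures d ↔ ∏ k ∈ Finset.Icc (1 : ℤ) d, (a - k * w) ≠ 0 := by
  rw [Finset.prod_ne_zero_iff, ← not_iff_not, not_not]
  simp only [invPunctures, Finset.mem_image, Finset.mem_Icc, not_forall, not_not]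
  constructor
  · rintro ⟨k, ⟨h1, h2⟩, h⟩
    have hk : (k : ℂ) ≠ 0 := by exact_mod_cast (by omega : k ≠ 0)
    refine ⟨k, ⟨by omega, by omega⟩, ?_⟩
    rw [inv_eq_one_div, div_eq_div_iff hk ha] at h
    push_cast
    linear_combination h
  · rintro ⟨k, ⟨h1, h2⟩, h⟩
    lift k to ℕ using by omega
    have hk : (k : ℂ) ≠ 0 := by exact_mod_cast (by omega : k ≠ 0)
    refine ⟨k, ⟨by omega, by omega⟩, ?_⟩
    rw [inv_eq_one_div, div_eq_div_iff hk ha]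
    push_cast at h
    linear_combination h

lemma toP2_mem_complement_iff {d₁ d₂ : ℕ} {v : {v : Fin 3 → ℂ // v ≠ 0}} (hv : v.1 0 ≠ 0) :
    toP2 v ∈ complement d₁ d₂ ↔
      v.1 1 / v.1 0 ∉ invPunctures d₁ ∧ v.1 2 / v.1 0 ∉ invPunctures d₂ := by
  rw [notMem_invPunctures hv, notMem_invPunctures hv, toP2_mem_complement, eval_f,
    mul_ne_zero_iff, mul_ne_zero_iff]
  tauto

/-- In the chart `x = 1` the complement is the product of two punctured planes. -/
noncomputable def complementHomeomorph (d₁ d₂ : ℕ) :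
    complement d₁ d₂ ≃ₜ ↥((invPunctures d₁ : Set ℂ)ᶜ) × ↥((invPunctures d₂ : Set ℂ)ᶜ) where
  toFun p := by
    have h : affineCoord 1 p ∉ invPunctures d₁ ∧ affineCoord 2 p ∉ invPunctures d₂ := by
      obtain ⟨p, hp⟩ := p
      obtain ⟨v, rfl⟩ := isQuotientMap_toP2.surjective p
      exact (toP2_mem_complement_iff (apply_zero_ne_zero_of_mem hp)).1 hp
    exact (⟨affineCoord 1 p, h.1⟩, ⟨affineCoord 2 p, h.2⟩)
  invFun w := ⟨toP2 (affineVec (w.1, w.2)), by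
    refine (toP2_mem_complement_iff (one_ne_zero (α := ℂ))).2 ?_
    simp only [affineVec, Matrix.cons_val, div_one]
    exact ⟨w.1.2, w.2.2⟩⟩
  left_inv := by
    rintro ⟨p, hp⟩
    obtain ⟨v, rfl⟩ := isQuotientMap_toP2.surjective p
    have hv := apply_zero_ne_zero_of_mem hp
    refine Subtype.ext ((Projectivization.mk_eq_mk_iff' ℂ _ _ _ _).2 ⟨(v.1 0)⁻¹, ?_⟩)
    ext i
    simp only [affineCoord_toP2]
    fin_cases i <;> simp [hv, div_eq_inv_mul]
  right_inv := by
    rintro ⟨w, w'⟩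
    refine Prod.ext (Subtype.ext ?_) (Subtype.ext ?_) <;>
    simp [affineCoord_toP2, affineVec]
  continuous_toFun := by
    exact ((continuous_affineCoord d₁ d₂ 1).subtype_mk _).prodMk
      ((continuous_affineCoord d₁ d₂ 2).subtype_mk _)
  continuous_invFun := by
    refine Continuous.subtype_mk ?_ _
    exact isQuotientMap_toP2.continuous.comp (continuous_affineVec.comp (by fun_prop))

theorem nonempty_complement_homeomorph (d₁ d₂ : ℕ) :
    Nonempty (complement d₁ d₂ ≃ₜ ↥((punctures d₁)ᶜ) × ↥((punctures d₂)ᶜ)) := by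
  obtain ⟨φ⟩ := nonempty_homeomorph_compl_punctures (invPunctures d₁)
  obtain ⟨ψ⟩ := nonempty_homeomorph_compl_punctures (invPunctures d₂)
  rw [card_invPunctures] at φ ψ
  exact ⟨(complementHomeomorph d₁ d₂).trans (φ.prodCongr ψ)⟩

/-! ### Strips and slit planes -/

/-- The plane with the points `1, …, d` removed. -/
abbrev Punctured (d : ℕ) : Type := ↥((punctures d)ᶜ)

/-- The open intervals into which the points `1, …, d` divide the real line. -/
def strip (d : ℕ) (j : Fin (d + 1)) : Set ℝ :=
  {x | (1 ≤ (j : ℕ) → (j : ℝ) < x) ∧ ((j : ℕ) < d → x < j + 1)}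

variable {d : ℕ}

instance ordConnected_strip (j : Fin (d + 1)) : (strip d j).OrdConnected :=
  ⟨fun _ hx _ hy _ hz => ⟨fun h => (hx.1 h).trans_le hz.1, fun h => hz.2.trans_lt (hy.2 h)⟩⟩

lemma isOpen_strip (j : Fin (d + 1)) : IsOpen (strip d j) := by
  refine IsOpen.and ?_ ?_
  · by_cases h : 1 ≤ (j : ℕ)
    · simp only [h, true_imp_iff]
      exact isOpen_lt continuous_const continuous_id
    · simp [h]
  · by_cases h : (j : ℕ) < d
    · simp only [h, true_imp_iff]
      exact isOpen_lt continuous_id continuous_const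
    · simp [h]

lemma add_half_mem_strip (j : Fin (d + 1)) : (j : ℝ) + 1 / 2 ∈ strip d j :=
  ⟨fun _ => by linarith, fun _ => by linarith⟩

lemma mem_punctures_ofReal {x : ℝ} :
    (x : ℂ) ∈ punctures d ↔ ∃ k : ℕ, (1 ≤ k ∧ k ≤ d) ∧ x = k := by
  simp only [punctures, Set.mem_image, Set.mem_Icc]
  refine exists_congr fun k => and_congr_right fun _ => ?_
  rw [eq_comm]
  exact_mod_cast Iff.rfl

lemma mem_punctures {z : ℂ} : z ∈ punctures d ↔ z.im = 0 ∧ (z.re : ℂ) ∈ punctures d := by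
  constructor
  · rintro ⟨k, hk, rfl⟩
    exact ⟨by simp, k, hk, by simp⟩
  · rintro ⟨h, h'⟩
    rwa [show z = (z.re : ℂ) from Complex.ext rfl (by simp [h])]

lemma notMem_punctures_of_mem_strip {x : ℝ} {j : Fin (d + 1)} (hx : x ∈ strip d j) :
    (x : ℂ) ∉ punctures d := by
  rw [mem_punctures_ofReal]
  rintro ⟨k, ⟨hk1, hk2⟩, rfl⟩
  rcases le_or_gt k j with h | h
  · have := hx.1 (hk1.trans h)
    exact absurd (Nat.cast_lt.1 this) (by omega)
  · have := hx.2 (h.trans_le hk2)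
    exact absurd (by exact_mod_cast this : k < (j : ℕ) + 1) (by omega)

/-- The index of the interval containing a given real number. -/
noncomputable def stripIndex (d : ℕ) (x : ℝ) : Fin (d + 1) :=
  -- The natural floor is 0 for negative x, which gives the leftmost interval; the cap at d gives
  -- the rightmost one.
  ⟨min ⌊x⌋₊ d, by omega⟩

lemma mem_strip_stripIndex {x : ℝ} (hx : (x : ℂ) ∉ punctures d) :
    x ∈ strip d (stripIndex d x) := by
  rw [mem_punctures_ofReal] at hx
  constructor
  · intro h
    simp only [stripIndex] at h ⊢
    have hle : ((min ⌊x⌋₊ d : ℕ) : ℝ) ≤ x := by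
      have h1 : 1 ≤ ⌊x⌋₊ := h.trans (min_le_left _ _)
      refine le_trans (Nat.cast_le.2 (min_le_left _ _)) (Nat.floor_le ?_)
      exact le_trans zero_le_one ((Nat.one_le_floor_iff x).1 h1)
    exact lt_of_le_of_ne hle fun e => hx ⟨_, ⟨h, min_le_right _ _⟩, e.symm⟩
  · intro h
    simp only [stripIndex] at h ⊢
    have : min ⌊x⌋₊ d = ⌊x⌋₊ := by omega
    rw [this]
    exact Nat.lt_floor_add_one x

lemma stripIndex_eq {x : ℝ} {j : Fin (d + 1)} (hx : x ∈ strip d j) : stripIndex d x = j := by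
  refine Fin.ext ?_
  simp only [stripIndex]
  have hj := j.2
  have h₁ : (j : ℕ) ≤ ⌊x⌋₊ := by
    rcases Nat.eq_zero_or_pos (j : ℕ) with h | h
    · omega
    · exact Nat.le_floor (hx.1 h).le
  rcases Nat.lt_or_ge (j : ℕ) d with h | h
  · have h2 : x < ((j + 1 : ℕ) : ℝ) := by exact_mod_cast hx.2 h
    have := (Nat.floor_lt' (by omega)).2 h2
    omega
  · omega

/-- The part of the punctured plane over the union of the strips. -/
def stripRegion (d : ℕ) : Set (Punctured d) := {z | (z.1.re : ℂ) ∉ punctures d}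

/-- The punctured plane cut along the vertical rays below (`ε = 1`) or above (`ε = -1`) the
punctures. -/
def slitRegion (d : ℕ) (ε : ℝ) : Set (Punctured d) := {z | 0 < ε * z.1.im} ∪ stripRegion d

lemma continuous_punctured_re : Continuous fun z : Punctured d => z.1.re :=
  Complex.continuous_re.comp continuous_subtype_val

lemma continuous_punctured_im : Continuous fun z : Punctured d => z.1.im :=
  Complex.continuous_im.comp continuous_subtype_val

lemma isOpen_setOf_stripIndex (A : Set (Fin (d + 1))) :
    IsOpen {z : Punctured d | z ∈ stripRegion d ∧ stripIndex d z.1.re ∈ A} := by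
  have : {z : Punctured d | z ∈ stripRegion d ∧ stripIndex d z.1.re ∈ A} =
      ⋃ j ∈ A, {z : Punctured d | z.1.re ∈ strip d j} := by
    ext z
    simp only [Set.mem_iUnion]
    constructor
    · rintro ⟨h, h'⟩
      exact ⟨_, h', mem_strip_stripIndex h⟩
    · rintro ⟨j, hj, h⟩
      refine ⟨notMem_punctures_of_mem_strip h, ?_⟩
      rwa [stripIndex_eq h]
  rw [this]
  exact isOpen_biUnion fun j _ => (isOpen_strip j).preimage continuous_punctured_re

lemma isOpen_stripRegion : IsOpen (stripRegion d) := by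
  simpa using isOpen_setOf_stripIndex (d := d) Set.univ

lemma isOpen_slitRegion (ε : ℝ) : IsOpen (slitRegion d ε) :=
  (isOpen_lt continuous_const (continuous_const.mul continuous_punctured_im)).union
    isOpen_stripRegion

lemma mem_stripRegion_of_im_eq_zero {z : Punctured d} (h : z.1.im = 0) : z ∈ stripRegion d :=
  fun h' => z.2 (mem_punctures.2 ⟨h, h'⟩)

lemma mem_slitRegion_one {z : Punctured d} (h : 0 ≤ z.1.im) : z ∈ slitRegion d 1 := by
  rcases h.lt_or_eq with h | h
  · exact .inl (by simpa using h)
  · exact .inr (mem_stripRegion_of_im_eq_zero h.symm)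

lemma mem_slitRegion_neg_one {z : Punctured d} (h : z.1.im ≤ 0) : z ∈ slitRegion d (-1) := by
  rcases h.lt_or_eq with h | h
  · exact .inl (by simpa using h)
  · exact .inr (mem_stripRegion_of_im_eq_zero h)

lemma slitRegion_inter : slitRegion d 1 ∩ slitRegion d (-1) = stripRegion d := by
  ext z
  constructor
  · rintro ⟨h | h, h' | h'⟩
    · simp only [Set.mem_ofPred_eq] at h h'
      linarith
    all_goals assumption
  · exact fun h => ⟨.inr h, .inr h⟩

lemma slitRegion_union : slitRegion d 1 ∪ slitRegion d (-1) = Set.univ :=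
  Set.eq_univ_of_forall fun z => (le_total 0 z.1.im).imp mem_slitRegion_one mem_slitRegion_neg_one

/-- From every point the vertical ray in direction ε stays in the region and enters the convex open
half plane. -/
lemma isPreconnected_slitRegion {ε : ℝ} (hε : ε ^ 2 = 1) : IsPreconnected (slitRegion d ε) := by
  have hI : (ε * Complex.I : ℂ) ∉ punctures d := fun h => by
    have := (mem_punctures.1 h).1
    simp only [Complex.mul_im, Complex.ofReal_re, Complex.I_im, Complex.ofReal_im, Complex.I_re,
      mul_one, mul_zero, add_zero] at this
    simp [this] at hε
  have pre : ∀ s : Set ℂ, s ⊆ (punctures d)ᶜ → IsPreconnected s →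
      IsPreconnected ((Subtype.val : Punctured d → ℂ) ⁻¹' s) := fun s hs h => by
    rw [← IsInducing.subtypeVal.isPreconnected_image, Subtype.image_preimage_coe,
      Set.inter_eq_right.2 hs]
    exact h
  have half : Convex ℝ {w : ℂ | 0 < ε * w.im} := by
    intro a ha b hb s t hs ht hst
    simp only [Set.mem_ofPred_eq, Complex.add_im, Complex.real_smul, Complex.mul_im,
      Complex.ofReal_re, Complex.ofReal_im, zero_mul, add_zero] at ha hb ⊢
    rcases hs.eq_or_lt with rfl | hs
    · simp only [zero_add] at hst
      simpa [hst] using hb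
    · nlinarith [mul_pos hs ha, mul_nonneg ht hb.le]
  refine isPreconnected_of_forall ⟨ε * Complex.I, hI⟩ fun z hz => ?_
  refine ⟨Subtype.val ⁻¹' ({w : ℂ | 0 < ε * w.im} ∪
    {w : ℂ | w.re = z.1.re ∧ ε * z.1.im ≤ ε * w.im}), ?_, .inl ?_, .inr ⟨rfl, le_rfl⟩, ?_⟩
  · rintro w (hw | ⟨hw1, hw2⟩)
    · exact .inl hw
    · rcases hz with hz | hz
      · exact .inl (lt_of_lt_of_le hz hw2)
      · refine .inr ?_
        simpa only [stripRegion, Set.mem_ofPred_eq, hw1] using hz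
  · have h : ε * (ε * Complex.I : ℂ).im = ε ^ 2 := by simp [sq]
    simp only [Set.mem_ofPred_eq, h, hε, one_pos]
  · refine pre _ ?_ ?_
    · rintro w (hw | ⟨hw1, hw2⟩) hwp
      · simp [(mem_punctures.1 hwp).1] at hw
      · obtain ⟨h1, h2⟩ := mem_punctures.1 hwp
        rw [h1, mul_zero] at hw2
        rcases hz with hz | hz
        · exact hw2.not_gt hz
        · exact hz (hw1 ▸ h2)
    · refine IsPreconnected.union (z.1.re + ε * (|z.1.im| + 1) * Complex.I : ℂ) ?_ ?_
        half.isPreconnected ?_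
      · have := abs_nonneg z.1.im
        simp only [Set.mem_ofPred_eq]
        simp
        nlinarith
      · refine ⟨by simp, ?_⟩
        have : ε * z.1.im ≤ |z.1.im| := by
          have h1 : |ε| = 1 := by
            rw [← sq_abs] at hε
            nlinarith [abs_nonneg ε]
          calc ε * z.1.im ≤ |ε * z.1.im| := le_abs_self _
            _ = |z.1.im| := by rw [abs_mul, h1, one_mul]
        have h : ε * (z.1.re + ε * (|z.1.im| + 1) * Complex.I : ℂ).im =
            ε ^ 2 * (|z.1.im| + 1) := by
          simp
          ring
        rw [h, hε]
        linarith
      · refine Convex.isPreconnected ?_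
        rintro a ⟨ha, ha'⟩ b ⟨hb, hb'⟩ s t hs ht hst
        simp only [Set.mem_ofPred_eq, Complex.add_im, Complex.add_re, Complex.real_smul,
          Complex.mul_im, Complex.mul_re, Complex.ofReal_re, Complex.ofReal_im, zero_mul, add_zero,
          sub_zero]
        refine ⟨by rw [ha, hb, ← add_mul, hst, one_mul], ?_⟩
        calc ε * z.1.im = s * (ε * z.1.im) + t * (ε * z.1.im) := by rw [← add_mul, hst, one_mul]
          _ ≤ s * (ε * a.im) + t * (ε * b.im) := by gcongr
          _ = _ := by ring

/-- The punctured plane retracts onto each of the intervals between the punctures. -/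
theorem exists_stripRetraction (j : Fin (d + 1)) : ∃ r : C(Punctured d, Punctured d),
    (∀ z, (r z).1.im = 0 ∧ (r z).1.re ∈ strip d j) ∧
      ∀ z, z.1.im = 0 → z.1.re ∈ strip d j → r z = z := by
  let A : Set (Punctured d) := {z | z.1.im = 0 ∧ z.1.re ∈ strip d j}
  have hA : IsClosed A := by
    -- The finite end points of the interval are punctures, so strict and weak inequalities agree on
    -- the real axis and the interval is closed in the punctured plane.
    have : A = {z : Punctured d | z.1.im = 0} ∩ ({z | 1 ≤ (j : ℕ) → (j : ℝ) ≤ z.1.re} ∩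
        {z | (j : ℕ) < d → z.1.re ≤ j + 1}) := by
      ext z
      refine and_congr_right fun h => and_congr (imp_congr_right fun hj => ?_)
        (imp_congr_right fun hj => ?_)
      all_goals
        refine ⟨le_of_lt, fun h' => lt_of_le_of_ne h' fun e => ?_⟩
        refine mem_stripRegion_of_im_eq_zero h (mem_punctures_ofReal.2 ?_)
      · exact ⟨j, ⟨hj, by omega⟩, e.symm⟩
      · exact ⟨j + 1, ⟨by omega, by omega⟩, by rw [e]; push_cast; rfl⟩
    rw [this]
    refine (isClosed_eq continuous_punctured_im continuous_const).inter (IsClosed.inter ?_ ?_)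
    · by_cases h : 1 ≤ (j : ℕ)
      · simpa only [h, true_imp_iff] using isClosed_le continuous_const continuous_punctured_re
      · simp [h]
    · by_cases h : (j : ℕ) < d
      · simpa only [h, true_imp_iff] using isClosed_le continuous_punctured_re continuous_const
      · simp [h]
  -- Tietze extension of the real part, with values kept in the interval.
  obtain ⟨g, hg, hgA⟩ := ContinuousMap.exists_restrict_eq_forall_mem_of_closed
    (⟨fun z : A => z.1.1.re, continuous_punctured_re.comp continuous_subtype_val⟩ : C(A, ℝ))
    (fun z => z.2.2) ⟨_, add_half_mem_strip j⟩ hA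
  refine ⟨⟨fun z => ⟨(g z : ℂ), notMem_punctures_of_mem_strip (hg z)⟩, by fun_prop⟩,
    fun z => ⟨by simp, by simpa using hg z⟩, fun z h h' => Subtype.ext ?_⟩
  have : g z = z.1.re := DFunLike.congr_fun hgA ⟨z, h, h'⟩
  exact Complex.ext (by simpa using this) (by simpa using h.symm)

/-- A retraction of the punctured plane onto an interval between the punctures. -/
noncomputable def stripRetraction (j : Fin (d + 1)) : C(Punctured d, Punctured d) :=
  (exists_stripRetraction j).choose

lemma stripRetraction_im (j : Fin (d + 1)) (z : Punctured d) :
    (stripRetraction j z).1.im = 0 := ((exists_stripRetraction j).choose_spec.1 z).1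

lemma stripRetraction_eq_self {j : Fin (d + 1)} {z : Punctured d} (h : z.1.im = 0)
    (h' : z.1.re ∈ strip d j) : stripRetraction j z = z :=
  (exists_stripRetraction j).choose_spec.2 z h h'

/-- The element of the free group which is attached to an interval: the trivial element for the
leftmost one, and the free generators for the others. -/
def stripGen (j : Fin (d + 1)) : FreeGroup (Fin d) :=
  Fin.cases (motive := fun _ => FreeGroup (Fin d)) 1 FreeGroup.of j

@[simp] lemma stripGen_zero : stripGen (0 : Fin (d + 1)) = 1 := rfl

@[simp] lemma stripGen_succ (a : Fin d) : stripGen a.succ = FreeGroup.of a := rfl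

/-- The transition function between the two sheets over a point of the strips. -/
noncomputable def cut (z : Punctured d) : FreeGroup (Fin d) := stripGen (stripIndex d z.1.re)

lemma cut_eq {z : Punctured d} {j : Fin (d + 1)} (h : z.1.re ∈ strip d j) :
    cut z = stripGen j := by
  rw [cut, stripIndex_eq h]

lemma isOpen_setOf_cut (A : Set (FreeGroup (Fin d))) :
    IsOpen {z : Punctured d | z ∈ stripRegion d ∧ cut z ∈ A} :=
  isOpen_setOf_stripIndex {j | stripGen j ∈ A}

/-! ### The covering space glued from slit planes -/

/-- The universal covering space of the punctured plane; its fibre is the free group. -/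
@[ext] structure Cover (d : ℕ) where
  /-- the projection to the punctured plane -/
  pt : Punctured d
  /-- the coordinate in the fibre -/
  elt : FreeGroup (Fin d)

namespace Cover

open scoped Classical in
/-- The fibre coordinate in the trivialization over the lower slit region. -/
noncomputable def lowerElt (z : Punctured d) (g : FreeGroup (Fin d)) : FreeGroup (Fin d) :=
  if z ∈ slitRegion d 1 then cut z * g else g

/-- The section over the upper slit region. -/
def upper (g : FreeGroup (Fin d)) (z : slitRegion d 1) : Cover d := ⟨z, g⟩

/-- The section over the lower slit region. -/
noncomputable def lower (g : FreeGroup (Fin d)) (z : slitRegion d (-1)) : Cover d :=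
  ⟨z, lowerElt z.1 g⟩

lemma lowerElt_of_mem {z : Punctured d} (h : z ∈ slitRegion d 1) (g : FreeGroup (Fin d)) :
    lowerElt z g = cut z * g := if_pos h

lemma lowerElt_injective (z : Punctured d) : Function.Injective (lowerElt z) := by
  intro g h e
  unfold lowerElt at e
  split_ifs at e
  · exact mul_left_cancel e
  · exact e

lemma lowerElt_mul (z : Punctured d) (g h : FreeGroup (Fin d)) :
    lowerElt z (g * h) = lowerElt z g * h := by
  unfold lowerElt
  split_ifs <;> simp [mul_assoc]

/-- The final topology for all sheets. Over the strips, `lower g` coincides with `upper (cut z *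
g)`, so this glues the sheets there. -/
noncomputable instance : TopologicalSpace (Cover d) :=
  (⨆ g, TopologicalSpace.coinduced (upper g) inferInstance) ⊔
    ⨆ g, TopologicalSpace.coinduced (lower g) inferInstance

lemma isOpen_iff {s : Set (Cover d)} :
    IsOpen s ↔ (∀ g, IsOpen (upper g ⁻¹' s)) ∧ ∀ g, IsOpen (lower g ⁻¹' s) := by
  refine Iff.trans (isOpen_sup (t₁ := ⨆ g, TopologicalSpace.coinduced (upper g) inferInstance)
    (t₂ := ⨆ g, TopologicalSpace.coinduced (lower g) inferInstance)) ?_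
  rw [isOpen_iSup_iff, isOpen_iSup_iff]
  rfl

lemma continuous_iff {Y : Type*} [TopologicalSpace Y] {φ : Cover d → Y} :
    Continuous φ ↔ (∀ g, Continuous (φ ∘ upper g)) ∧ ∀ g, Continuous (φ ∘ lower g) := by
  simp only [continuous_def, isOpen_iff, Set.preimage_comp]
  exact ⟨fun h => ⟨fun g s hs => (h s hs).1 g, fun g s hs => (h s hs).2 g⟩,
    fun h s hs => ⟨fun g => h.1 g s hs, fun g => h.2 g s hs⟩⟩

lemma continuous_upper (g : FreeGroup (Fin d)) : Continuous (upper g) :=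
  (continuous_iff.1 continuous_id).1 g

lemma continuous_lower (g : FreeGroup (Fin d)) : Continuous (lower g) :=
  (continuous_iff.1 continuous_id).2 g

lemma continuous_pt : Continuous (pt : Cover d → Punctured d) :=
  continuous_iff.2 ⟨fun _ => continuous_subtype_val, fun _ => continuous_subtype_val⟩

lemma exists_eq_upper_or_lower (e : Cover d) :
    (∃ g z, e = upper g z) ∨ ∃ g z, e = lower g z := by
  obtain ⟨z, g⟩ := e
  by_cases h : z ∈ slitRegion d 1
  · exact .inl ⟨g, ⟨z, h⟩, rfl⟩
  · refine .inr ⟨g, ⟨z, ?_⟩, ?_⟩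
    · have : z ∈ slitRegion d 1 ∪ slitRegion d (-1) := slitRegion_union ▸ trivial
      exact this.resolve_left h
    · simp [lower, lowerElt, h]

/-- A lower sheet meets this sheet exactly over those strips whose transition element matches the
labels, and such a union of strips is open. -/
lemma isOpen_range_upper (g : FreeGroup (Fin d)) : IsOpen (Set.range (upper g)) := by
  refine isOpen_iff.2 ⟨fun h => ?_, fun h => ?_⟩
  · by_cases e : g = h
    · subst e
      simp
    · convert! isOpen_empty
      refine Set.eq_empty_of_forall_notMem ?_
      rintro z ⟨w, hw⟩
      exact e (congr_arg elt hw)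
  · convert! (isOpen_setOf_cut {a | a * h = g}).preimage continuous_subtype_val
    ext z
    constructor
    · rintro ⟨w, hw⟩
      have hz : w.1 = z.1 := congr_arg pt hw
      have hw1 : z.1 ∈ slitRegion d 1 := hz ▸ w.2
      refine ⟨slitRegion_inter ▸ ⟨hw1, z.2⟩, ?_⟩
      have := congr_arg elt hw
      simp only [lower, lowerElt_of_mem hw1] at this
      exact this.symm
    · rintro ⟨hz, hz'⟩
      have hz1 : z.1 ∈ slitRegion d 1 := .inr hz
      exact ⟨⟨z.1, hz1⟩, Cover.ext rfl (by rw [lower, lowerElt_of_mem hz1]; exact hz'.symm)⟩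

lemma isOpen_range_lower (g : FreeGroup (Fin d)) : IsOpen (Set.range (lower g)) := by
  refine isOpen_iff.2 ⟨fun h => ?_, fun h => ?_⟩
  · convert! (isOpen_setOf_cut {a | a * g = h}).preimage continuous_subtype_val
    ext z
    constructor
    · rintro ⟨w, hw⟩
      have hz : w.1 = z.1 := congr_arg pt hw
      have hw1 : z.1 ∈ slitRegion d (-1) := hz ▸ w.2
      refine ⟨slitRegion_inter ▸ ⟨z.2, hw1⟩, ?_⟩
      have := congr_arg elt hw
      simp only [lower, hz, lowerElt_of_mem z.2] at this
      exact this
    · rintro ⟨hz, hz'⟩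
      have hz1 : z.1 ∈ slitRegion d (-1) := .inr hz
      exact ⟨⟨z.1, hz1⟩, Cover.ext rfl (by
        simp only [lower, lowerElt_of_mem z.2]; exact hz')⟩
  · by_cases e : g = h
    · subst e
      simp
    · convert! isOpen_empty
      refine Set.eq_empty_of_forall_notMem ?_
      rintro z ⟨w, hw⟩
      have hz : w.1 = z.1 := congr_arg pt hw
      have := congr_arg elt hw
      simp only [lower, hz] at this
      exact e (lowerElt_injective _ this)

/-- The gluing multiplies labels on the left, so right multiplication respects it; the inverse makes
it a left action. -/
instance : MulAction (FreeGroup (Fin d)) (Cover d) where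
  smul a e := ⟨e.pt, e.elt * a⁻¹⟩
  one_smul e := Cover.ext rfl (by change e.elt * 1⁻¹ = _; simp)
  mul_smul a b e := Cover.ext rfl (by
    change e.elt * (a * b)⁻¹ = e.elt * b⁻¹ * a⁻¹
    simp [mul_assoc])

lemma smul_lower (a g : FreeGroup (Fin d)) (z : slitRegion d (-1)) :
    a • lower g z = lower (g * a⁻¹) z :=
  Cover.ext rfl (lowerElt_mul _ _ _).symm

/-- Openness downstairs is tested with the two sections of label 1. A nontrivial element carries
each sheet to a disjoint sheet of the same kind. -/
theorem isQuotientCoveringMap_pt :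
    IsQuotientCoveringMap (pt : Cover d → Punctured d) (FreeGroup (Fin d)) where
  toIsQuotientMap := by
    refine ⟨isCoinducing_iff.2 fun s => ⟨fun h => ?_, fun h => h.preimage continuous_pt⟩,
      fun z => ⟨⟨z, 1⟩, rfl⟩⟩
    have h₁ := (isOpen_slitRegion 1).isOpenMap_subtype_val _ ((isOpen_iff.1 h).1 1)
    have h₂ := (isOpen_slitRegion (-1)).isOpenMap_subtype_val _ ((isOpen_iff.1 h).2 1)
    convert! h₁.union h₂
    ext z
    constructor
    · intro hz
      have : z ∈ slitRegion d 1 ∪ slitRegion d (-1) := slitRegion_union ▸ trivial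
      exact this.imp (fun h => ⟨⟨z, h⟩, hz, rfl⟩) fun h => ⟨⟨z, h⟩, hz, rfl⟩
    · rintro (⟨z, hz, rfl⟩ | ⟨z, hz, rfl⟩) <;> exact hz
  toContinuousConstSMul := ⟨fun a => continuous_iff.2
    ⟨fun g => continuous_upper (g * a⁻¹), fun g => by
      convert! continuous_lower (g * a⁻¹)
      exact funext (smul_lower a g)⟩⟩
  apply_eq_iff_mem_orbit {e e'} := by
    constructor
    · intro h
      refine ⟨e.elt⁻¹ * e'.elt, Cover.ext h.symm ?_⟩
      change e'.elt * (e.elt⁻¹ * e'.elt)⁻¹ = e.elt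
      simp
    · rintro ⟨a, rfl⟩
      rfl
  disjoint e := by
    rcases exists_eq_upper_or_lower e with ⟨g, z, rfl⟩ | ⟨g, z, rfl⟩
    · refine ⟨_, (isOpen_range_upper g).mem_nhds ⟨z, rfl⟩, ?_⟩
      rintro a ⟨-, ⟨-, ⟨w, rfl⟩, rfl⟩, ⟨w', h⟩⟩
      have : g = g * a⁻¹ := congr_arg elt h
      simpa using this
    · refine ⟨_, (isOpen_range_lower g).mem_nhds ⟨z, rfl⟩, ?_⟩
      rintro a ⟨-, ⟨-, ⟨w, rfl⟩, rfl⟩, ⟨w', h⟩⟩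
      simp only [smul_lower] at h
      have hw : w'.1 = w.1 := congr_arg pt h
      have h' := congr_arg elt h
      simp only [lower, hw] at h'
      simpa using lowerElt_injective _ h'

/-- The point `j + 1/2` of the interval with index `j`. -/
noncomputable def stripPoint (j : Fin (d + 1)) : Punctured d :=
  ⟨(((j : ℝ) + 1 / 2 : ℝ) : ℂ), notMem_punctures_of_mem_strip (add_half_mem_strip j)⟩

lemma stripPoint_mem (j : Fin (d + 1)) : stripPoint j ∈ stripRegion d :=
  mem_stripRegion_of_im_eq_zero (Complex.ofReal_im _)

lemma cut_stripPoint (j : Fin (d + 1)) : cut (stripPoint j) = stripGen j :=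
  cut_eq (by simpa only [stripPoint, Complex.ofReal_re] using add_half_mem_strip j)

lemma isPreconnected_range_upper (g : FreeGroup (Fin d)) : IsPreconnected (Set.range (upper g)) := by
  have := isPreconnected_iff_preconnectedSpace.1
    (isPreconnected_slitRegion (d := d) (ε := 1) (by norm_num))
  exact isPreconnected_range (continuous_upper g)

lemma isPreconnected_range_lower (g : FreeGroup (Fin d)) : IsPreconnected (Set.range (lower g)) := by
  have := isPreconnected_iff_preconnectedSpace.1
    (isPreconnected_slitRegion (d := d) (ε := -1) (by norm_num))
  exact isPreconnected_range (continuous_lower g)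

lemma range_lower_inter_range_upper (j : Fin (d + 1)) (g : FreeGroup (Fin d)) :
    (Set.range (lower g) ∩ Set.range (upper (stripGen j * g))).Nonempty := by
  have h : stripPoint j ∈ slitRegion d 1 := .inr (stripPoint_mem j)
  refine ⟨upper (stripGen j * g) ⟨_, h⟩, ⟨⟨stripPoint j, .inr (stripPoint_mem j)⟩, ?_⟩, ⟨_, rfl⟩⟩
  refine Cover.ext rfl ?_
  rw [lower, lowerElt_of_mem h, cut_stripPoint]
  rfl

/-- Sheets are connected, and strip 0 followed by strip `a.succ` leads from upper sheet h to upper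
sheet a h. The reverse route gives a⁻¹ h, so every sheet is reached from the label 1. -/
instance : PreconnectedSpace (Cover d) := by
  let e₀ : Cover d := ⟨stripPoint 0, 1⟩
  have touchU : ∀ g, (Set.range (upper g) ∩ connectedComponent e₀).Nonempty →
      Set.range (upper g) ⊆ connectedComponent e₀ := by
    rintro g ⟨x, hx, hx'⟩
    rw [connectedComponent_eq hx']
    exact (isPreconnected_range_upper g).subset_connectedComponent hx
  have touchL : ∀ g, (Set.range (lower g) ∩ connectedComponent e₀).Nonempty →
      Set.range (lower g) ⊆ connectedComponent e₀ := by
    rintro g ⟨x, hx, hx'⟩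
    rw [connectedComponent_eq hx']
    exact (isPreconnected_range_lower g).subset_connectedComponent hx
  have lowerOf : ∀ j g, Set.range (upper (stripGen j * g)) ⊆ connectedComponent e₀ →
      Set.range (lower g) ⊆ connectedComponent e₀ := fun j g h =>
    touchL g ((range_lower_inter_range_upper j g).mono (Set.inter_subset_inter_right _ h))
  have upperOf : ∀ j g, Set.range (lower g) ⊆ connectedComponent e₀ →
      Set.range (upper (stripGen j * g)) ⊆ connectedComponent e₀ := fun j g h =>
    touchU _ ((range_lower_inter_range_upper j g).mono fun x hx => ⟨hx.2, h hx.1⟩)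
  have all : ∀ g h, Set.range (upper h) ⊆ connectedComponent e₀ →
      Set.range (upper (g * h)) ⊆ connectedComponent e₀ := by
    intro g
    induction g using FreeGroup.induction_on with
    | C1 => simp
    | of a =>
      intro h hh
      exact upperOf a.succ h (lowerOf 0 h (by simpa using hh))
    | inv_of a _ =>
      intro h hh
      have := upperOf 0 _ (lowerOf a.succ ((FreeGroup.of a)⁻¹ * h) (by simpa using hh))
      simpa using this
    | mul a b ha hb =>
      intro h hh
      rw [mul_assoc]
      exact ha _ (hb _ hh)
  have h₁ : Set.range (upper 1) ⊆ connectedComponent e₀ :=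
    touchU 1 ⟨e₀, ⟨⟨stripPoint 0, .inr (stripPoint_mem 0)⟩, rfl⟩, mem_connectedComponent⟩
  have hU : ∀ g, Set.range (upper g) ⊆ connectedComponent e₀ := fun g => by
    simpa using all g 1 h₁
  refine preconnectedSpace_iff_connectedComponent.2 fun x => ?_
  have hx : ∀ y, y ∈ connectedComponent e₀ := fun y => by
    rcases exists_eq_upper_or_lower y with ⟨g, z, rfl⟩ | ⟨g, z, rfl⟩
    · exact hU g ⟨z, rfl⟩
    · exact lowerOf 0 g (by simpa using hU g) ⟨z, rfl⟩
  rw [← connectedComponent_eq (hx x)]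
  exact Set.eq_univ_of_forall hx

end Cover

/-! ### Contracting the half planes sheet by sheet -/

/-- A path in the half plane `0 ≤ ε * im` from `z` to the real point `w`, depending continuously
on its end points, and constant when these agree. -/
noncomputable def detour (ε : ℝ) (z w : ℂ) (t : ℝ) : ℂ :=
  (1 - t) * z + t * w + (ε * (t * (1 - t) * ‖z - w‖) : ℝ) * Complex.I

lemma detour_zero (ε : ℝ) (z w : ℂ) : detour ε z w 0 = z := by simp [detour]

lemma detour_one (ε : ℝ) (z w : ℂ) : detour ε z w 1 = w := by simp [detour]

lemma detour_self (ε : ℝ) (z : ℂ) (t : ℝ) : detour ε z z t = z := by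
  simp only [detour, sub_self, norm_zero, mul_zero, Complex.ofReal_zero, zero_mul]
  ring

lemma detour_im (ε : ℝ) (z w : ℂ) (t : ℝ) :
    (detour ε z w t).im = (1 - t) * z.im + t * w.im + ε * (t * (1 - t) * ‖z - w‖) := by
  have h : ((1 - t : ℂ)) = ((1 - t : ℝ) : ℂ) := by push_cast; rfl
  rw [detour, h]
  simp only [Complex.add_im, Complex.im_ofReal_mul, Complex.I_im, mul_one]

/-- A straight segment between real points could hit a puncture. The added bump makes ε · im
strictly positive at interior times whenever z ≠ w. -/
lemma detour_notMem_punctures {ε t : ℝ} (hε : ε ^ 2 = 1) {z w : ℂ} (hz : z ∉ punctures d)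
    (hw : w ∉ punctures d) (hzε : 0 ≤ ε * z.im) (hw0 : w.im = 0) (ht : t ∈ Set.Icc (0 : ℝ) 1) :
    detour ε z w t ∉ punctures d := by
  rcases ht.1.eq_or_lt with rfl | h0
  · rwa [detour_zero]
  rcases ht.2.eq_or_lt with rfl | h1
  · rwa [detour_one]
  rcases eq_or_ne z w with rfl | hne
  · rwa [detour_self]
  intro h
  have him := (mem_punctures.1 h).1
  rw [detour_im, hw0] at him
  have hpos : 0 < t * (1 - t) * ‖z - w‖ :=
    mul_pos (mul_pos h0 (sub_pos.2 h1)) (norm_pos_iff.2 (sub_ne_zero.2 hne))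
  have h2 : 0 ≤ (1 - t) * (ε * z.im) := mul_nonneg (sub_pos.2 h1).le hzε
  have h3 : (1 - t) * (ε * z.im) + ε ^ 2 * (t * (1 - t) * ‖z - w‖) = 0 := by
    linear_combination ε * him
  rw [hε] at h3
  linarith

/-- The times at which the successive stages of the homotopy take place. -/
noncomputable def stageTime (k : ℕ) : ℝ := 1 - 1 / (k + 1)

lemma stageTime_zero : stageTime 0 = 0 := by simp [stageTime]

lemma stageTime_lt_succ (k : ℕ) : stageTime k < stageTime (k + 1) := by
  unfold stageTime
  push_cast
  have : (1 : ℝ) / (k + 1 + 1) < 1 / (k + 1) :=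
    one_div_lt_one_div_of_lt (by positivity) (by linarith)
  linarith

/-- Infinitely many stages fit before time 1, so sheets of every depth are finished by then although
word lengths are unbounded. -/
lemma stageTime_le_one (k : ℕ) : stageTime k ≤ 1 := by
  unfold stageTime
  have : (0 : ℝ) ≤ 1 / (k + 1) := by positivity
  linarith

lemma stageTime_nonneg (k : ℕ) : 0 ≤ stageTime k := by
  unfold stageTime
  have : (1 : ℝ) / (k + 1) ≤ 1 := by
    rw [div_le_one (by positivity)]
    linarith [k.cast_nonneg (α := ℝ)]
  linarith

/-- The function which decreases from `1` to `0` during the stage `k`. -/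
noncomputable def ramp (k : ℕ) (s : ℝ) : ℝ :=
  max 0 (min 1 ((stageTime (k + 1) - s) / (stageTime (k + 1) - stageTime k)))

lemma ramp_mem (k : ℕ) (s : ℝ) : ramp k s ∈ Set.Icc (0 : ℝ) 1 :=
  ⟨le_max_left _ _, max_le zero_le_one (min_le_left _ _)⟩

lemma ramp_eq_one {k : ℕ} {s : ℝ} (h : s ≤ stageTime k) : ramp k s = 1 := by
  have := stageTime_lt_succ k
  have h1 : 1 ≤ (stageTime (k + 1) - s) / (stageTime (k + 1) - stageTime k) := by
    rw [one_le_div (by linarith)]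
    linarith
  rw [ramp, min_eq_left h1, max_eq_right zero_le_one]

lemma ramp_eq_zero {k : ℕ} {s : ℝ} (h : stageTime (k + 1) ≤ s) : ramp k s = 0 := by
  have := stageTime_lt_succ k
  exact max_eq_left ((min_le_right _ _).trans
    (div_nonpos_of_nonpos_of_nonneg (by linarith) (by linarith)))

lemma continuous_ramp (k : ℕ) : Continuous (ramp k) := by
  unfold ramp
  fun_prop

/-- A family of maps from the punctured plane to the plane, together with a number of stages. -/
abbrev SheetHomotopy (d : ℕ) : Type := C(Punctured d × ℝ, ℂ) × ℕ

/-- On the half plane `0 ≤ ε * im` the family avoids the punctures; it starts with the constant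
map `i`, and it is the inclusion from the end of its last stage on. -/
structure SheetHomotopy.IsContraction (ε : ℝ) (A : SheetHomotopy d) : Prop where
  notMem : ∀ z : Punctured d, 0 ≤ ε * z.1.im → ∀ s, A.1 (z, s) ∉ punctures d
  start : ∀ z : Punctured d, 0 ≤ ε * z.1.im → ∀ s ≤ 0, A.1 (z, s) = Complex.I
  final : ∀ z : Punctured d, 0 ≤ ε * z.1.im → ∀ s, stageTime (A.2 + 1) ≤ s → A.1 (z, s) = z

/-- The contraction of the upper half plane to `i`. -/
noncomputable def rootHomotopy (d : ℕ) : SheetHomotopy d :=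
  (⟨fun q => (1 - ramp 0 q.2) * q.1.1 + ramp 0 q.2 * Complex.I, by
    have := continuous_ramp 0
    fun_prop⟩, 0)

lemma rootHomotopy_apply (z : Punctured d) (s : ℝ) :
    (rootHomotopy d).1 (z, s) = (1 - ramp 0 s) * z.1 + ramp 0 s * Complex.I := rfl

lemma isContraction_rootHomotopy : (rootHomotopy d).IsContraction 1 where
  notMem z hz s := by
    rw [rootHomotopy_apply]
    obtain ⟨h0, h1⟩ := ramp_mem 0 s
    rcases h0.eq_or_lt with h | h
    · rw [← h, Complex.ofReal_zero, sub_zero, one_mul, zero_mul, add_zero]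
      exact z.2
    · intro hp
      have him := (mem_punctures.1 hp).1
      rw [show (1 - (ramp 0 s : ℂ)) = ((1 - ramp 0 s : ℝ) : ℂ) by push_cast; rfl] at him
      simp only [Complex.add_im, Complex.im_ofReal_mul, Complex.I_im, mul_one] at him
      rw [one_mul] at hz
      have := mul_nonneg (sub_nonneg.2 h1) hz
      linarith
  start z _ s hs := by
    rw [rootHomotopy_apply, ramp_eq_one (by rwa [stageTime_zero])]
    simp
  final z _ s hs := by
    have h : ramp 0 s = 0 := ramp_eq_zero hs
    rw [rootHomotopy_apply, h]
    simp

/-- Extend a homotopy from an interval to an adjacent half plane. -/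
noncomputable def SheetHomotopy.extend (ε : ℝ) (j : Fin (d + 1)) (A : SheetHomotopy d) :
    SheetHomotopy d :=
  -- A concatenation without case distinction. Until the new stage the detour sits at the retracted
  -- point and cancels the subtraction; afterwards `A` has arrived there and only the detour back to
  -- z remains.
  (⟨fun q => A.1 (stripRetraction j q.1, q.2) - (stripRetraction j q.1).1 +
      detour ε q.1 (stripRetraction j q.1).1 (ramp (A.2 + 1) q.2), by
    have := continuous_ramp (A.2 + 1)
    unfold detour
    fun_prop⟩, A.2 + 1)

lemma SheetHomotopy.extend_apply (ε : ℝ) (j : Fin (d + 1)) (A : SheetHomotopy d)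
    (z : Punctured d) (s : ℝ) : (A.extend ε j).1 (z, s) =
      A.1 (stripRetraction j z, s) - (stripRetraction j z).1 +
        detour ε z (stripRetraction j z).1 (ramp (A.2 + 1) s) := rfl

/-- The signs are independent because `A` is evaluated only at real points, which lie in both closed
half planes. -/
lemma SheetHomotopy.IsContraction.extend {ε ε' : ℝ} (hε : ε ^ 2 = 1) (j : Fin (d + 1))
    {A : SheetHomotopy d} (hA : A.IsContraction ε') : (A.extend ε j).IsContraction ε := by
  have hr : ∀ z, 0 ≤ ε' * (stripRetraction j z).1.im := fun z => by
    rw [stripRetraction_im, mul_zero]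
  have early : ∀ z s, s ≤ stageTime (A.2 + 1) →
      (A.extend ε j).1 (z, s) = A.1 (stripRetraction j z, s) := fun z s hs => by
    rw [extend_apply, ramp_eq_one hs, detour_one, sub_add_cancel]
  have late : ∀ z s, stageTime (A.2 + 1) ≤ s → (A.extend ε j).1 (z, s) =
      detour ε z (stripRetraction j z).1 (ramp (A.2 + 1) s) := fun z s hs => by
    rw [extend_apply, hA.final _ (hr z) s hs, sub_self, zero_add]
  refine ⟨fun z hz s => ?_, fun z hz s hs => ?_, fun z hz s hs => ?_⟩
  · rcases le_total s (stageTime (A.2 + 1)) with h | h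
    · rw [early z s h]
      exact hA.notMem _ (hr z) s
    · rw [late z s h]
      exact detour_notMem_punctures hε z.2 (stripRetraction j z).2 hz (stripRetraction_im j z)
        (ramp_mem _ _)
  · rw [early z s (hs.trans (stageTime_nonneg _))]
    exact hA.start _ (hr z) s hs
  · have h : ramp (A.2 + 1) s = 0 := ramp_eq_zero hs
    rw [late z s ((stageTime_lt_succ _).le.trans hs), h, detour_zero]

/-- Two families agree on the interval with index `j`. -/
def SheetHomotopy.Agree (j : Fin (d + 1)) (A B : SheetHomotopy d) : Prop :=
  ∀ z : Punctured d, z.1.im = 0 → z.1.re ∈ strip d j → ∀ s, A.1 (z, s) = B.1 (z, s)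

lemma SheetHomotopy.Agree.symm {j : Fin (d + 1)} {A B : SheetHomotopy d} (h : Agree j A B) :
    Agree j B A := fun z hz hz' s => (h z hz hz' s).symm

/-- On the interval the retraction is the identity and the detour stands still, so the extra stage
changes nothing at any time. -/
lemma SheetHomotopy.agree_extend (ε : ℝ) (j : Fin (d + 1)) (A : SheetHomotopy d) :
    Agree j A (A.extend ε j) := fun z hz hz' s => by
  rw [extend_apply, stripRetraction_eq_self hz hz', detour_self, sub_add_cancel]

open SheetHomotopy

/-- The homotopies on the upper and the lower half plane of the sheet which belongs to a word;
the recursion follows the tree of sheets. -/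
noncomputable def sheets : List (Fin d × Bool) → SheetHomotopy d × SheetHomotopy d
  | [] => (rootHomotopy d, (rootHomotopy d).extend (-1) 0)
  -- Upper sheet a g meets lower sheet g over strip `a.succ`, and lower sheet a⁻¹ g meets upper
  -- sheet g there. That half is defined first; its partner follows across strip 0.
  | (a, true) :: L => ((sheets L).2.extend 1 a.succ, ((sheets L).2.extend 1 a.succ).extend (-1) 0)
  | (a, false) :: L => (((sheets L).1.extend (-1) a.succ).extend 1 0, (sheets L).1.extend (-1) a.succ)

lemma isContraction_sheets (L : List (Fin d × Bool)) :
    (sheets L).1.IsContraction 1 ∧ (sheets L).2.IsContraction (-1) := by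
  have h₁ : (1 : ℝ) ^ 2 = 1 := by norm_num
  have h₂ : (-1 : ℝ) ^ 2 = 1 := by norm_num
  induction L with
  | nil => exact ⟨isContraction_rootHomotopy, isContraction_rootHomotopy.extend h₂ 0⟩
  | cons x L ih =>
    obtain ⟨a, b⟩ := x
    cases b
    · exact ⟨(ih.1.extend h₂ a.succ).extend h₁ 0, ih.1.extend h₂ a.succ⟩
    · exact ⟨ih.2.extend h₁ a.succ, (ih.2.extend h₁ a.succ).extend h₂ 0⟩

lemma agree_sheets_zero (L : List (Fin d × Bool)) : Agree 0 (sheets L).1 (sheets L).2 := by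
  rcases L with _ | ⟨⟨a, b⟩, L⟩
  · exact agree_extend _ _ _
  · cases b
    · exact (agree_extend _ _ _).symm
    · exact agree_extend _ _ _

/-- Of two neighbours in the Cayley tree, one is the parent of the other, so the recursion defining
`sheets` relates them directly. -/
lemma toWord_of_mul (a : Fin d) (g : FreeGroup (Fin d)) :
    (FreeGroup.of a * g).toWord = (a, true) :: g.toWord ∨
      g.toWord = (a, false) :: (FreeGroup.of a * g).toWord := by
  have h : (FreeGroup.of a * g).toWord = FreeGroup.reduce ((a, true) :: g.toWord) := by
    rw [FreeGroup.toWord_mul, FreeGroup.toWord_of]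
    rfl
  rw [h, FreeGroup.reduce.cons, FreeGroup.reduce_toWord]
  rcases hg : g.toWord with _ | ⟨⟨b, c⟩, L⟩
  · exact .inl rfl
  · simp only
    split_ifs with hc
    · obtain ⟨rfl, hc⟩ := hc
      refine .inr ?_
      cases c
      · rfl
      · simp at hc
    · exact .inl rfl

/-- The homotopies of adjacent sheets agree on the interval along which these are glued. -/
lemma agree_sheets (j : Fin (d + 1)) (g : FreeGroup (Fin d)) :
    Agree j (sheets (stripGen j * g).toWord).1 (sheets g.toWord).2 := by
  refine Fin.cases ?_ (fun a => ?_) j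
  · simpa using agree_sheets_zero g.toWord
  · rw [stripGen_succ]
    rcases toWord_of_mul a g with h | h
    · rw [h]
      exact (agree_extend _ _ _).symm
    · rw [h]
      exact agree_extend _ _ _

/-! ### The null-homotopy of the projection -/

namespace Cover

open scoped Classical in
/-- The homotopy from the constant map to the covering projection. -/
noncomputable def contraction (e : Cover d) (s : ℝ) : ℂ :=
  if 0 ≤ e.pt.1.im then (sheets e.elt.toWord).1.1 (e.pt, s)
  else (sheets (if e.pt ∈ slitRegion d 1 then (cut e.pt)⁻¹ * e.elt else e.elt).toWord).2.1 (e.pt, s)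

lemma contraction_upper (g : FreeGroup (Fin d)) (z : slitRegion d 1) (s : ℝ) :
    contraction (upper g z) s = if 0 ≤ z.1.1.im then (sheets g.toWord).1.1 (z.1, s)
      else (sheets ((cut z.1)⁻¹ * g).toWord).2.1 (z.1, s) := by
  simp only [contraction, upper, z.2, if_true]

lemma contraction_lower (g : FreeGroup (Fin d)) (z : slitRegion d (-1)) (s : ℝ) :
    contraction (lower g z) s = if 0 ≤ z.1.1.im then (sheets (cut z.1 * g).toWord).1.1 (z.1, s)
      else (sheets g.toWord).2.1 (z.1, s) := by
  simp only [contraction, lower]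
  by_cases h : z.1 ∈ slitRegion d 1
  · simp only [lowerElt_of_mem h, h, if_true, inv_mul_cancel_left]
  · have : ¬ 0 ≤ z.1.1.im := fun h' => h (mem_slitRegion_one h')
    simp only [this, h, lowerElt, if_false]

lemma contraction_notMem (e : Cover d) (s : ℝ) : contraction e s ∉ punctures d := by
  unfold contraction
  split_ifs with h
  · exact (isContraction_sheets _).1.notMem _ (by simpa using h) s
  all_goals exact (isContraction_sheets _).2.notMem _ (by linarith) s

lemma contraction_start (e : Cover d) : contraction e 0 = Complex.I := by
  unfold contraction
  split_ifs with h
  · exact (isContraction_sheets _).1.start _ (by simpa using h) 0 le_rfl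
  all_goals exact (isContraction_sheets _).2.start _ (by linarith) 0 le_rfl

lemma contraction_final (e : Cover d) : contraction e 1 = e.pt := by
  unfold contraction
  split_ifs with h
  · exact (isContraction_sheets _).1.final _ (by simpa using h) 1 (stageTime_le_one _)
  all_goals exact (isContraction_sheets _).2.final _ (by linarith) 1 (stageTime_le_one _)

/-- Continuity of a function which is given by two sheets glued along the intervals. -/
lemma continuous_glue {U : Set (Punctured d)} (P N : Fin (d + 1) → SheetHomotopy d)
    (hPN : ∀ j, Agree j (P j) (N j)) {φ : U × ℝ → ℂ}
    (hφ : ∀ q, φ q = if 0 ≤ q.1.1.1.im then (P (stripIndex d q.1.1.1.re)).1 (q.1.1, q.2)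
      else (N (stripIndex d q.1.1.1.re)).1 (q.1.1, q.2))
    (hU : ∀ q₀ : U × ℝ, q₀.1.1 ∉ stripRegion d → ContinuousAt φ q₀) : Continuous φ := by
  rw [continuous_iff_continuousAt]
  intro q₀
  by_cases h₀ : q₀.1.1 ∈ stripRegion d
  swap
  · exact hU q₀ h₀
  let j := stripIndex d q₀.1.1.1.re
  have hre : Continuous fun q : U × ℝ => q.1.1.1.re :=
    continuous_punctured_re.comp (continuous_subtype_val.comp continuous_fst)
  have him : Continuous fun q : U × ℝ => q.1.1.1.im :=
    continuous_punctured_im.comp (continuous_subtype_val.comp continuous_fst)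
  let V : Set (U × ℝ) := {q | q.1.1.1.re ∈ strip d j}
  have hV : IsOpen V := (isOpen_strip j).preimage hre
  have hq₀ : q₀ ∈ V := mem_strip_stripIndex h₀
  -- Over one strip the index is constant, so there are only two continuous pieces, which agree on
  -- the real axis.
  have hc : ContinuousOn (fun q : U × ℝ => if 0 ≤ q.1.1.1.im then (P j).1 (q.1.1, q.2)
      else (N j).1 (q.1.1, q.2)) V := by
    refine ContinuousOn.if ?_ (by fun_prop) (by fun_prop)
    rintro q ⟨hq, hq'⟩
    exact hPN j q.1.1 (frontier_le_subset_eq continuous_const him hq').symm hq q.2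
  refine (hc.continuousAt (hV.mem_nhds hq₀)).congr ?_
  filter_upwards [hV.mem_nhds hq₀] with q hq
  rw [hφ, stripIndex_eq hq]

lemma continuous_contraction_upper (g : FreeGroup (Fin d)) :
    Continuous fun q : slitRegion d 1 × ℝ => contraction (upper g q.1) q.2 := by
  refine continuous_glue (fun _ => sheets g.toWord |>.1)
    (fun j => (sheets ((stripGen j)⁻¹ * g).toWord).2) (fun j => ?_)
    (fun q => contraction_upper g q.1 q.2) fun q₀ h₀ => ?_
  · simpa using agree_sheets j ((stripGen j)⁻¹ * g)
  · have hpos : 0 < q₀.1.1.1.im := by simpa using q₀.1.2.resolve_right h₀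
    have him : Continuous fun q : slitRegion d 1 × ℝ => q.1.1.1.im :=
      continuous_punctured_im.comp (continuous_subtype_val.comp continuous_fst)
    have hc : Continuous fun q : slitRegion d 1 × ℝ => (sheets g.toWord).1.1 (q.1.1, q.2) := by
      fun_prop
    refine hc.continuousAt.congr ?_
    filter_upwards [(isOpen_lt continuous_const him).mem_nhds hpos] with q hq
    rw [contraction_upper, if_pos (le_of_lt hq)]

lemma continuous_contraction_lower (g : FreeGroup (Fin d)) :
    Continuous fun q : slitRegion d (-1) × ℝ => contraction (lower g q.1) q.2 := by
  refine continuous_glue (fun j => (sheets (stripGen j * g).toWord).1)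
    (fun _ => (sheets g.toWord).2) (fun j => agree_sheets j g)
    (fun q => contraction_lower g q.1 q.2) fun q₀ h₀ => ?_
  have hneg : q₀.1.1.1.im < 0 := by simpa using q₀.1.2.resolve_right h₀
  have him : Continuous fun q : slitRegion d (-1) × ℝ => q.1.1.1.im :=
    continuous_punctured_im.comp (continuous_subtype_val.comp continuous_fst)
  have hc : Continuous fun q : slitRegion d (-1) × ℝ => (sheets g.toWord).2.1 (q.1.1, q.2) := by
    fun_prop
  refine hc.continuousAt.congr ?_
  filter_upwards [(isOpen_lt him continuous_const).mem_nhds hneg] with q hq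
  rw [contraction_lower, if_neg (not_le.2 hq)]

/-- The paths from the base point to the points of the punctured plane which are parametrized by
the covering space. -/
noncomputable def contractionPath (e : Cover d) : C(I, Punctured d) where
  toFun s := ⟨contraction e s, contraction_notMem e s⟩
  continuous_toFun := by
    refine Continuous.subtype_mk ?_ _
    rcases exists_eq_upper_or_lower e with ⟨g, z, rfl⟩ | ⟨g, z, rfl⟩
    · exact (continuous_contraction_upper g).comp (by fun_prop : Continuous fun s : I => (z, (s : ℝ)))
    · exact (continuous_contraction_lower g).comp (by fun_prop : Continuous fun s : I => (z, (s : ℝ)))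

/-- Currying keeps the domain equal to `Cover d`, whose final topology lets continuity be tested on
each sheet. -/
lemma continuous_contractionPath : Continuous (contractionPath : Cover d → C(I, Punctured d)) := by
  refine continuous_iff.2 ⟨fun g => ?_, fun g => ?_⟩
  · refine ContinuousMap.continuous_of_continuous_uncurry _ (Continuous.subtype_mk ?_ _)
    exact (continuous_contraction_upper g).comp
      (by fun_prop : Continuous fun q : slitRegion d 1 × I => (q.1, (q.2 : ℝ)))
  · refine ContinuousMap.continuous_of_continuous_uncurry _ (Continuous.subtype_mk ?_ _)
    exact (continuous_contraction_lower g).comp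
      (by fun_prop : Continuous fun q : slitRegion d (-1) × I => (q.1, (q.2 : ℝ)))

end Cover

/-! ### Contractibility of the covering space and conclusion -/

/-- A connected covering space is contractible if its projection is null-homotopic. -/
theorem contractibleSpace_of_nullhomotopic {E X : Type*} [TopologicalSpace E] [TopologicalSpace X]
    [PreconnectedSpace E] [Nonempty E] {p : C(E, X)} (hp : IsCoveringMap p)
    (h : p.Nullhomotopic) : ContractibleSpace E := by
  obtain ⟨x, ⟨H⟩⟩ := h
  have h₀ : ∀ e, H.toContinuousMap (0, e) = p (ContinuousMap.id E e) := H.apply_zero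
  let L := hp.liftHomotopy H.toContinuousMap (.id E) h₀
  have hL : ∀ q, p (L q) = H q := congr_fun (hp.liftHomotopy_lifts H.toContinuousMap (.id E) h₀)
  rw [contractible_iff_id_nullhomotopic]
  obtain ⟨e₀⟩ := ‹Nonempty E›
  refine ⟨L (1, e₀), ⟨{
    toContinuousMap := L
    map_zero_left := hp.liftHomotopy_zero H.toContinuousMap (.id E) h₀
    map_one_left := fun e => ?_ }⟩⟩
  -- The lifted homotopy ends inside a single fibre, which is discrete, and `E` is connected.
  exact hp.const_of_comp (g := fun e => L (1, e)) (by fun_prop)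
    (fun a b => by rw [hL, hL, H.apply_one, H.apply_one]; rfl) e e₀

instance : ContractibleSpace (Cover d) := by
  have : Nonempty (Cover d) := ⟨⟨Cover.stripPoint 0, 1⟩⟩
  have hI : Complex.I ∉ punctures d := fun h => by simpa using (mem_punctures.1 h).1
  refine contractibleSpace_of_nullhomotopic
    (p := (⟨Cover.pt, Cover.continuous_pt⟩ : C(Cover d, Punctured d)))
    (Cover.isQuotientCoveringMap_pt.isCoveringMap) ⟨⟨Complex.I, hI⟩, ⟨ContinuousMap.Homotopy.symm {
      toFun := fun q => Cover.contractionPath q.2 q.1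
      continuous_toFun := (Cover.continuous_contractionPath.comp continuous_snd).eval continuous_fst
      map_zero_left := fun e => Subtype.ext (Cover.contraction_start e)
      map_one_left := fun e => Subtype.ext (Cover.contraction_final e) }⟩⟩

theorem isKPiOne_compl_punctures (d : ℕ) : IsKPiOne (FreeGroup (Fin d)) ↥((punctures d)ᶜ) :=
  IsKPiOne.of_isQuotientCoveringMap Cover.isQuotientCoveringMap_pt

end LineArr

theorem proposition4p2 (d₁ d₂ : ℕ) (h₁ : 1 ≤ d₁) (h₁₂ : d₁ ≤ d₂) :
    (∀ S T : Finset ℂ, S.card = d₁ → T.card = d₂ →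
      Nonempty (↥(LineArr.complement d₁ d₂) ≃ₜ
        (↥((S : Set ℂ)ᶜ) × ↥((T : Set ℂ)ᶜ)))) ∧
    LineArr.IsKPiOne (FreeGroup (Fin d₁) × FreeGroup (Fin d₂))
      ↥(LineArr.complement d₁ d₂) := by
  obtain ⟨χ⟩ := LineArr.nonempty_complement_homeomorph d₁ d₂
  refine ⟨?_, ((LineArr.isKPiOne_compl_punctures d₁).prod
    (LineArr.isKPiOne_compl_punctures d₂)).of_homeomorph χ⟩
  rintro S T rfl rfl
  obtain ⟨φ⟩ := LineArr.nonempty_homeomorph_compl_punctures S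
  obtain ⟨ψ⟩ := LineArr.nonempty_homeomorph_compl_punctures T
  exact ⟨χ.trans (φ.symm.prodCongr ψ.symm)⟩
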